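/- Let $G$ be a polycyclic group, that is, a group with a finite subnormal series $1=G_0\lhd G_1\lhd\dots\lhd G_m=G$ all of whose factors $G_{i+1}/G_i$ are cyclic. Suppose that $G$ is not virtually nilpotent, i.e. $G$ has no nilpotent subgroup of finite index. Then there exist an element $x\in G$ and normal nilpotent subgroups $K\le H$ of $G$ such that $H/K$ is infinite and abelian and $\langle x,H\rangle/K$ is not virtually nilpotent, where $\langle x,H\rangle$ denotes the subgroup of $G$ generated by $x$ and $H$. -/

import Mathlib

/-- A group `G` is polycyclic if it has a finite subnormal series
`1 = s 0 ⊴ s 1 ⊴ ⋯ ⊴ s n = G` all of whose factors `s (i + 1) / s i` are cyclic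
(finite or infinite). The values of `s` beyond `n` play no role. -/
def IsPolycyclicGroup (G : Type*) [Group G] : Prop :=
  ∃ (n : ℕ) (s : ℕ → Subgroup G), s 0 = ⊥ ∧ s n = ⊤ ∧
    ∀ i < n, s i ≤ s (i + 1) ∧
      ∃ _ : ((s i).subgroupOf (s (i + 1))).Normal,
        IsCyclic (↥(s (i + 1)) ⧸ (s i).subgroupOf (s (i + 1)))

/-! Let `F` be the largest nilpotent normal subgroup of `G`, and suppose no triple `x`, `K`, `H`
works. Test the consecutive lower central terms `H = γ_i F`, `K = γ_{i+1} F`: if `H/K` is infinite,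
then `⟨x,H⟩/K` is virtually nilpotent, so some power of `x` acts nilpotently on `H/K`; if it is
finite, some power acts trivially. A common power `x^k` thus acts nilpotently on every factor, so
`⟨F, x^k⟩` is nilpotent. If `A` is an abelian normal subgroup of `G/F` with preimage `C`, and `x ∈
C`, then `⟨F, x^k⟩` is normal in `C`, so it lies in `F`. Hence `A` is torsion and finitely
generated, so finite. A solvable group with finitely generated subgroups whose abelian normal
subgroups are all finite is finite; so `F` has finite index, a contradiction. -/

open scoped commutatorElement

namespace Subgroup

/-! ### Nilpotency criteria and Fitting's theorem -/

variable {G : Type*} [Group G]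

/-- If `G` is generated by `X ∪ Y`, and `S 0 ⊆ K` is an ascending sequence of sets each of which
is centralized by `X` modulo `K` and moved by `Y` into the preceding one, then `S j` lies in the
`j`-th term of the upper central series modulo `K`. -/
theorem subset_comap_upperCentralSeries (K : Subgroup G) [K.Normal] {X Y : Set G}
    (hXY : closure (X ∪ Y) = ⊤) (S : ℕ → Set G) (h0 : S 0 ⊆ K)
    (hX : ∀ j, ∀ a ∈ S j, ∀ x ∈ X, ⁅a, x⁆ ∈ K)
    (hY : ∀ j, ∀ a ∈ S (j + 1), ∀ y ∈ Y, ⁅a, y⁆ ∈ S j) (j : ℕ) :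
    S j ⊆ (upperCentralSeries (G ⧸ K) j).comap (QuotientGroup.mk' K) := by
  induction j with
  | zero =>
    intro a ha
    simpa using h0 ha
  | succ j ih =>
    intro a ha
    set U := (upperCentralSeries (G ⧸ K) j).comap (QuotientGroup.mk' K)
    have hUn : U.Normal := inferInstance
    have hK : K ≤ U := QuotientGroup.le_comap_mk' K _
    have key : ∀ g : G, ⁅a, g⁆ ∈ U := by
      intro g
      have hg : g ∈ closure (X ∪ Y) := hXY ▸ mem_top g
      induction hg using closure_induction with
      | mem x hx =>
        rcases hx with hx | hx
        · exact hK (hX _ a ha x hx)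
        · exact ih (hY j a ha x hx)
      | one => simp
      | mul x y _ _ hx hy =>
        rw [commutatorElement_mul_right_eq_mul_conj]
        simpa [mul_assoc] using
          U.mul_mem hx (hUn.conj_mem _ hy x)
      | inv x _ hx =>
        rw [commutatorElement_inv_right, ← commutatorElement_inv]
        simpa using hUn.conj_mem _ (U.inv_mem hx) x⁻¹
    rw [SetLike.mem_coe, mem_comap, mem_upperCentralSeries_succ_iff]
    intro y
    obtain ⟨g, rfl⟩ := QuotientGroup.mk'_surjective K y
    rw [← map_commutatorElement]
    exact key g

theorem lowerCentralSeries_le_of_le_comap_upperCentralSeries (K : Subgroup G) [K.Normal]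
    {c m : ℕ} (h : (⊤ : Subgroup G).lowerCentralSeries c ≤
      (upperCentralSeries (G ⧸ K) m).comap (QuotientGroup.mk' K)) :
    (⊤ : Subgroup G).lowerCentralSeries (c + m) ≤ K := by
  induction m generalizing c with
  | zero =>
    intro x hx
    simpa using h hx
  | succ m ih =>
    rw [← add_assoc, add_right_comm]
    refine ih ?_
    rw [lowerCentralSeries_succ, commutator_le]
    intro a ha g _
    rw [mem_comap, map_commutatorElement]
    exact mem_upperCentralSeries_succ_iff.mp (h ha) _

/-- A nilpotency criterion: `G` is generated by a nilpotent normal subgroup `N` and a set `Y` that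
acts nilpotently on the factors of the lower central series of `N`. -/
theorem isNilpotent_of_lowerCentralSeries_filtration (N : Subgroup G) [N.Normal]
    (hN : Group.IsNilpotent N) {Y : Set G} (hNY : closure ((N : Set G) ∪ Y) = ⊤) {c : ℕ}
    (hc : (⊤ : Subgroup G).lowerCentralSeries c ≤ N)
    (hS : ∀ i, ∃ (m : ℕ) (S : ℕ → Set G), S 0 ⊆ N.lowerCentralSeries (i + 1) ∧
      (N.lowerCentralSeries i : Set G) ⊆ S m ∧
      (∀ j, S j ⊆ N.lowerCentralSeries i) ∧
      ∀ j, ∀ a ∈ S (j + 1), ∀ y ∈ Y, ⁅a, y⁆ ∈ S j) :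
    Group.IsNilpotent G := by
  obtain ⟨n, hn⟩ := (isNilpotent_iff_lowerCentralSeries N).mp hN
  suffices h : ∀ i, ∃ c, (⊤ : Subgroup G).lowerCentralSeries c ≤ N.lowerCentralSeries i by
    obtain ⟨c, hc⟩ := h n
    exact nilpotent_iff_lowerCentralSeries.mpr ⟨c, le_bot_iff.mp (hn ▸ hc)⟩
  intro i
  induction i with
  | zero => exact ⟨c, hc⟩
  | succ i ih =>
    obtain ⟨d, hd⟩ := ih
    obtain ⟨m, S, h0, hm, hsub, hY⟩ := hS i
    refine ⟨d + m, lowerCentralSeries_le_of_le_comap_upperCentralSeries _ (le_trans hd ?_)⟩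
    exact hm.trans (subset_comap_upperCentralSeries _ hNY S h0
      (fun j a ha x hx => commutator_mem_commutator (hsub j ha) hx) hY m)

theorem lowerCentralSeries_sup_le (A B : Subgroup G) [A.Normal] (n : ℕ) :
    (A ⊔ B).lowerCentralSeries n ≤ A ⊔ B.lowerCentralSeries n := by
  have h : ∀ H : Subgroup G, A ⊔ H = (H.map (QuotientGroup.mk' A)).comap (QuotientGroup.mk' A) := by
    intro H
    rw [comap_map_eq, QuotientGroup.ker_mk', sup_comm]
  rw [h (B.lowerCentralSeries n), ← map_le_iff_le_comap, map_lowerCentralSeries,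
    map_lowerCentralSeries, map_sup]
  refine lowerCentralSeries_mono n (sup_le ?_ le_rfl)
  rw [QuotientGroup.map_mk'_self]
  exact bot_le

theorem isNilpotent_of_sup_eq_top {A B : Subgroup G} [A.Normal] [B.Normal]
    (hA : Group.IsNilpotent A) (hB : Group.IsNilpotent B) (h : A ⊔ B = ⊤) :
    Group.IsNilpotent G := by
  obtain ⟨b, hb⟩ := (isNilpotent_iff_lowerCentralSeries B).mp hB
  refine isNilpotent_of_lowerCentralSeries_filtration A hA (Y := (B : Set G)) (c := b) ?_ ?_ ?_
  · rw [closure_union, closure_eq, closure_eq, h]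
  · rw [← h]
    simpa [hb] using lowerCentralSeries_sup_le A B b
  · intro i
    -- Commuting with `B` descends its lower central series, so the index `b - j` counts down. The
    -- guard `j ≤ b` drops the condition at `j = b + 1`, where the set is all of `γ_i A`.
    refine ⟨b + 1, fun j => {a | a ∈ A.lowerCentralSeries i ∧
      (j ≤ b → a ∈ B.lowerCentralSeries (b - j))}, ?_, ?_, ?_, ?_⟩
    · rintro a ⟨-, ha⟩
      have := ha (Nat.zero_le b)
      rw [Nat.sub_zero, hb, mem_bot] at this
      rw [this]
      exact one_mem _
    · intro a ha
      exact ⟨ha, fun h => by omega⟩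
    · intro j a ha
      exact ha.1
    · rintro j a ⟨ha, ha'⟩ y hy
      refine ⟨commutator_le_left _ B (commutator_mem_commutator ha hy), fun hj => ?_⟩
      rcases hj.lt_or_eq with hj | rfl
      · have := commutator_mem_commutator (ha' hj) hy
        rwa [← lowerCentralSeries_succ, show b - (j + 1) + 1 = b - j by omega] at this
      · rw [Nat.sub_self]
        exact commutator_le_right A B
          (commutator_mem_commutator (lowerCentralSeries_le_self A i ha) hy)

theorem isNilpotent_subgroupOf_iff {A C : Subgroup G} (h : A ≤ C) :
    Group.IsNilpotent (A.subgroupOf C) ↔ Group.IsNilpotent A :=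
  Group.isNilpotent_congr (subgroupOfEquivOfLe h)

/-- **Fitting's theorem** -/
theorem isNilpotent_sup {A B : Subgroup G} [A.Normal] [B.Normal]
    (hA : Group.IsNilpotent A) (hB : Group.IsNilpotent B) :
    Group.IsNilpotent (A ⊔ B : Subgroup G) := by
  refine isNilpotent_of_sup_eq_top (A := A.subgroupOf (A ⊔ B)) (B := B.subgroupOf (A ⊔ B))
    ((isNilpotent_subgroupOf_iff le_sup_left).mpr hA)
    ((isNilpotent_subgroupOf_iff le_sup_right).mpr hB) ?_
  rw [← subgroupOf_sup le_sup_left le_sup_right, subgroupOf_self]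

/-- The subgroup generated by a nilpotent normal subgroup `N` and one element acting nilpotently
on the factors of the lower central series of `N` is nilpotent. -/
theorem isNilpotent_closure_insert {N : Subgroup G} [N.Normal] (hN : Group.IsNilpotent N) (y : G)
    (hy : ∀ i, ∃ m : ℕ, ∀ a ∈ N.lowerCentralSeries i,
      (fun b => ⁅b, y⁆)^[m] a ∈ N.lowerCentralSeries (i + 1)) :
    Group.IsNilpotent (closure ((N : Set G) ∪ {y})) := by
  set E := closure ((N : Set G) ∪ {y}) with hE
  have hNE : N ≤ E := fun x hx => subset_closure (Or.inl hx)
  have hyE : y ∈ E := subset_closure (Or.inr rfl)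
  have hlcs : ∀ i, (N.subgroupOf E).lowerCentralSeries i =
      (N.lowerCentralSeries i).subgroupOf E := by
    intro i
    refine map_injective E.subtype_injective ?_
    rw [map_lowerCentralSeries, map_subgroupOf_eq_of_le hNE,
      map_subgroupOf_eq_of_le ((lowerCentralSeries_le_self N i).trans hNE)]
  have hgen : closure ((N.subgroupOf E : Set E) ∪ {⟨y, hyE⟩}) = ⊤ := by
    refine map_injective E.subtype_injective ?_
    rw [MonoidHom.map_closure, ← MonoidHom.range_eq_map, range_subtype, Set.image_union,
      Set.image_singleton, ← coe_map, map_subgroupOf_eq_of_le hNE]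
    rfl
  refine isNilpotent_of_lowerCentralSeries_filtration (N.subgroupOf E)
    ((isNilpotent_subgroupOf_iff hNE).mpr hN) hgen (c := 1) ?_ ?_
  -- `c = 1` suffices: `E/N` is cyclic, generated by the image of `y`, hence abelian.
  · rw [lowerCentralSeries_succ, lowerCentralSeries_zero]
    have hsurj : ∀ q : E ⧸ N.subgroupOf E, q ∈ zpowers
        (QuotientGroup.mk' (N.subgroupOf E) ⟨y, hyE⟩) := by
      intro q
      obtain ⟨g, rfl⟩ := QuotientGroup.mk'_surjective _ q
      have hg : g ∈ closure ((N.subgroupOf E : Set E) ∪ {⟨y, hyE⟩}) := hgen ▸ mem_top g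
      rw [← mem_comap]
      refine (closure_le _).mpr ?_ hg
      rintro x (hx | rfl)
      · have : QuotientGroup.mk' (N.subgroupOf E) x = 1 := by simpa using hx
        rw [SetLike.mem_coe, mem_comap, this]
        exact one_mem _
      · exact mem_zpowers _
    rw [commutator_le]
    intro a _ b _
    rw [← QuotientGroup.ker_mk' (N.subgroupOf E), MonoidHom.mem_ker, map_commutatorElement,
      commutatorElement_eq_one_iff_mul_comm]
    obtain ⟨p, hp⟩ := hsurj (QuotientGroup.mk' _ a)
    obtain ⟨q, hq⟩ := hsurj (QuotientGroup.mk' _ b)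
    rw [← hp, ← hq]
    exact zpow_mul_comm _ p q
  · intro i
    obtain ⟨m, hm⟩ := hy i
    have hit : ∀ (j : ℕ) (a : E), (((fun b => ⁅b, (⟨y, hyE⟩ : E)⁆)^[j] a : E) : G) =
        (fun b => ⁅b, y⁆)^[j] (a : G) := fun j =>
      (Function.Semiconj.iterate_right (f := ((↑) : E → G)) (fun b => rfl) j)
    refine ⟨m, fun j => {a | a ∈ (N.subgroupOf E).lowerCentralSeries i ∧
      (fun b => ⁅b, (⟨y, hyE⟩ : E)⁆)^[j] a ∈ (N.subgroupOf E).lowerCentralSeries (i + 1)},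
      fun a ha => ha.2, ?_, fun j a ha => ha.1, ?_⟩
    · intro a ha
      refine ⟨ha, ?_⟩
      rw [SetLike.mem_coe, hlcs, mem_subgroupOf] at ha
      rw [hlcs, mem_subgroupOf, hit]
      exact hm _ ha
    · rintro j a ⟨ha, ha'⟩ _ rfl
      exact ⟨commutator_le_left _ ⊤ (commutator_mem_commutator ha (mem_top _)), ha'⟩

/-! ### Maximal condition and the Fitting subgroup -/

theorem wellFoundedGT_of_forall_fg (h : ∀ H : Subgroup G, H.FG) : WellFoundedGT (Subgroup G) := by
  rw [wellFoundedGT_iff_monotone_chain_condition]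
  intro f
  obtain ⟨S, hS⟩ := h (⨆ n, f n)
  have hex : ∀ x ∈ S, ∃ n, x ∈ f n := by
    intro x hx
    have : x ∈ ⨆ n, f n := hS ▸ subset_closure hx
    rwa [mem_iSup_of_directed f.monotone.directed_le] at this
  choose! g hg using hex
  refine ⟨S.sup g, fun m hm => le_antisymm (f.monotone hm) ?_⟩
  refine (le_iSup f m).trans ?_
  rw [← hS, closure_le]
  exact fun x hx => f.monotone (Finset.le_sup hx) (hg x hx)

theorem forall_fg_subtype (h : ∀ H : Subgroup G, H.FG) (C : Subgroup G) (H : Subgroup C) :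
    H.FG := by
  rw [← Group.fg_iff_subgroup_fg]
  have := (Group.fg_iff_subgroup_fg _).mpr (h (H.map C.subtype))
  exact Group.fg_of_surjective (f := (H.equivMapOfInjective _ C.subtype_injective).symm.toMonoidHom)
    (MulEquiv.surjective _)

theorem forall_fg_quotient (h : ∀ H : Subgroup G, H.FG) (N : Subgroup G) [N.Normal]
    (H : Subgroup (G ⧸ N)) : H.FG := by
  rw [← Group.fg_iff_subgroup_fg]
  have := (Group.fg_iff_subgroup_fg _).mpr (h (H.comap (QuotientGroup.mk' N)))
  exact Group.fg_of_surjective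
    (MonoidHom.subgroupComap_surjective_of_surjective _ H (QuotientGroup.mk'_surjective N))

/-- If all subgroups of `G` are finitely generated, then `G` has a largest nilpotent normal
subgroup, and it is characteristic. -/
theorem exists_greatest_nilpotent_normal (h : ∀ H : Subgroup G, H.FG) :
    ∃ F : Subgroup G, F.Characteristic ∧ Group.IsNilpotent F ∧
      ∀ N : Subgroup G, N.Normal → Group.IsNilpotent N → N ≤ F := by
  have := wellFoundedGT_of_forall_fg h
  set s : Set (Subgroup G) := {N | N.Normal ∧ Group.IsNilpotent N} with hs
  have hmem : sSup s ∈ s := by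
    refine CompleteLattice.IsSupFiniteCompact.isSupClosedCompact _
      (CompleteLattice.WellFoundedGT.isSupFiniteCompact _) s
      ⟨⊥, inferInstance, inferInstance⟩ ?_
    rintro A ⟨hA, hA'⟩ B ⟨hB, hB'⟩
    exact ⟨inferInstance, isNilpotent_sup hA' hB'⟩
  refine ⟨sSup s, ?_, hmem.2, fun N hN hN' => le_sSup ⟨hN, hN'⟩⟩
  rw [characteristic_iff_map_le]
  intro φ
  exact le_sSup ⟨hmem.1.map _ φ.surjective,
    (Group.isNilpotent_congr ((sSup s).equivMapOfInjective φ.toMonoidHom φ.injective)).mp hmem.2⟩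

/-- Nilpotent normal subgroups of normal subgroups lie in the largest nilpotent normal subgroup. -/
theorem le_of_isNilpotent_of_normal_subgroupOf (h : ∀ H : Subgroup G, H.FG) {F : Subgroup G}
    (hF : ∀ N : Subgroup G, N.Normal → Group.IsNilpotent N → N ≤ F) {C E : Subgroup G} [C.Normal]
    (hEC : E ≤ C) [(E.subgroupOf C).Normal] (hE : Group.IsNilpotent E) : E ≤ F := by
  obtain ⟨D, hD, hD', hmax⟩ := exists_greatest_nilpotent_normal (forall_fg_subtype h C)
  -- `D` is characteristic in the normal subgroup `C`, so its image is normal in `G`.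
  have h1 : D.map C.subtype ≤ F := hF _ inferInstance
    ((Group.isNilpotent_congr (D.equivMapOfInjective _ C.subtype_injective)).mp hD')
  have h2 : E.subgroupOf C ≤ D := hmax _ inferInstance ((isNilpotent_subgroupOf_iff hEC).mpr hE)
  rw [← map_subgroupOf_eq_of_le hEC]
  exact (map_mono h2).trans h1

end Subgroup

open Subgroup

/-! ### Engel powers and finiteness -/

theorem MonoidHom.map_commutator_iterate {A B : Type*} [Group A] [Group B] (f : A →* B) (y a : A)
    (m : ℕ) : f ((fun b => ⁅b, y⁆)^[m] a) = (fun b => ⁅b, f y⁆)^[m] (f a) :=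
  Function.Semiconj.iterate_right (f := f) (fun b => map_commutatorElement f b y) m a

/-- The index of a nilpotent normal subgroup `R` serves as `k`: commuting with an element of `R`
first enters `R`, then descends its lower central series. Allowing all multiples of `k` lets several
exponents be combined. -/
theorem Group.IsVirtuallyNilpotent.exists_pow_engel {Q : Type*} [Group Q]
    (hQ : Group.IsVirtuallyNilpotent Q) :
    ∃ k > 0, ∀ (y : Q) (l : ℕ), k ∣ l → ∃ m : ℕ, ∀ a : Q, (fun b => ⁅b, y ^ l⁆)^[m] a = 1 := by
  obtain ⟨R₀, hR₀, hfin⟩ := hQ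
  set R := R₀.normalCore with hR
  have hRn : Group.IsNilpotent R := (isNilpotent_subgroupOf_iff R₀.normalCore_le).mp inferInstance
  obtain ⟨n, hn⟩ := (isNilpotent_iff_lowerCentralSeries R).mp hRn
  refine ⟨R.index, Nat.pos_of_ne_zero FiniteIndex.index_ne_zero, ?_⟩
  rintro y _ ⟨l, rfl⟩
  have hy : y ^ (R.index * l) ∈ R := by
    rw [pow_mul]
    exact pow_mem (R.pow_index_mem y) l
  refine ⟨n + 1, fun a => ?_⟩
  suffices h : ∀ j, (fun b => ⁅b, y ^ (R.index * l)⁆)^[j + 1] a ∈ R.lowerCentralSeries j by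
    simpa [hn] using h n
  intro j
  induction j with
  | zero => exact commutator_le_right ⊤ R (commutator_mem_commutator (mem_top a) hy)
  | succ j ih =>
    rw [Function.iterate_succ_apply']
    exact commutator_mem_commutator ih hy

/-- If every abelian normal subgroup of a solvable group with finitely generated subgroups is
finite, then so is the group. -/
theorem Group.finite_of_forall_abelian_normal_finite {Q : Type*} [Group Q] [Group.IsSolvable Q]
    (hfg : ∀ H : Subgroup Q, H.FG)
    (hab : ∀ A : Subgroup Q, A.Normal → IsMulCommutative A → Finite A) : Finite Q := by
  -- A finitely generated group with finitely many commutators has centre of finite index. Here the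
  -- centre is abelian and normal in `Q`, hence finite. This step climbs the derived series from the
  -- bottom.
  have step : ∀ A : Subgroup Q, A.Normal → Finite (⁅A, A⁆ : Subgroup Q) → Finite A := by
    intro A hA hfin
    have : Group.FG A := (Group.fg_iff_subgroup_fg A).mpr (hfg A)
    have : Finite (commutatorSet A) := by
      refine Finite.of_injective
        (fun x => (⟨((x : A) : Q), ?_⟩ : (⁅A, A⁆ : Subgroup Q))) ?_
      · obtain ⟨_, a, b, rfl⟩ := x
        exact commutator_mem_commutator a.2 b.2
      · intro x y hxy
        have h := congrArg Subtype.val hxy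
        exact Subtype.ext (Subtype.ext h)
    have hZ : Finite ((center A).map A.subtype) := by
      refine hab _ inferInstance ?_
      infer_instance
    have : Finite (center A) :=
      Finite.of_equiv _ ((center A).equivMapOfInjective _ A.subtype_injective).symm.toEquiv
    exact (center A).finite_iff_finite_and_finiteIndex.mpr ⟨inferInstance, inferInstance⟩
  obtain ⟨n, hn⟩ := ‹Group.IsSolvable Q›
  have key : ∀ j ≤ n, Finite (derivedSeries Q (n - j)) := by
    intro j
    induction j with
    | zero =>
      intro _
      rw [Nat.sub_zero, hn]
      infer_instance
    | succ j ih =>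
      intro hj
      refine step _ inferInstance ?_
      rw [← derivedSeries_succ, show n - (j + 1) + 1 = n - j by omega]
      exact ih (by omega)
  have := key n le_rfl
  rw [Nat.sub_self, derivedSeries_zero] at this
  exact Finite.of_equiv _ (topEquiv (G := Q)).toEquiv

/-! ### Polycyclic groups -/

theorem IsPolycyclicGroup.forall_fg_and_isSolvable {G : Type*} [Group G]
    (hG : IsPolycyclicGroup G) : (∀ H : Subgroup G, H.FG) ∧ Group.IsSolvable G := by
  obtain ⟨n, s, h0, hn, hs⟩ := hG
  suffices h : ∀ i ≤ n, (∀ H ≤ s i, H.FG) ∧ Group.IsSolvable (s i) by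
    obtain ⟨h1, h2⟩ := h n le_rfl
    rw [hn] at h1 h2
    exact ⟨fun H => h1 H le_top, Group.isSolvable_of_surjective (f := (topEquiv (G := G)).toMonoidHom)
      topEquiv.surjective⟩
  intro i
  induction i with
  | zero =>
    intro _
    rw [h0]
    refine ⟨fun H hH => ?_, inferInstance⟩
    rw [le_bot_iff.mp hH]
    exact FG.bot
  | succ i ih =>
    intro hi
    obtain ⟨ih1, ih2⟩ := ih (by omega)
    obtain ⟨hle, hnorm, hcyc⟩ := hs i hi
    refine ⟨fun H hH => ?_, ?_⟩
    · let f : H →* s (i + 1) ⧸ (s i).subgroupOf (s (i + 1)) :=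
        (QuotientGroup.mk' _).comp (inclusion hH)
      obtain ⟨⟨_, g, rfl⟩, hgen⟩ := IsCyclic.exists_generator (α := f.range)
      -- `g` lifts a generator of the image of `H` in the cyclic factor.
      have hHeq : H = (H ⊓ s i) ⊔ zpowers (g : G) := by
        apply le_antisymm
        · intro x hx
          obtain ⟨k, hk⟩ := mem_zpowers_iff.mp (hgen ⟨f ⟨x, hx⟩, ⟨x, hx⟩, rfl⟩)
          have hk' : f (⟨x, hx⟩ * (g ^ k)⁻¹) = 1 := by
            rw [map_mul, map_inv, map_zpow, mul_inv_eq_one]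
            exact (congrArg Subtype.val hk).symm
          have hmem : x * ((g : G) ^ k)⁻¹ ∈ s i := by
            exact mem_subgroupOf.mp ((QuotientGroup.eq_one_iff _).mp hk')
          rw [← inv_mul_cancel_right x ((g : G) ^ k)]
          refine mul_mem (mem_sup_left ⟨?_, hmem⟩) (mem_sup_right (zpow_mem (mem_zpowers _) k))
          exact H.mul_mem hx (H.inv_mem (H.zpow_mem g.2 k))
        · exact sup_le inf_le_left (by simp)
      rw [hHeq]
      exact (ih1 _ inf_le_right).sup ⟨{(g : G)}, by simp [zpowers_eq_closure]⟩
    · have : Group.IsSolvable (s (i + 1) ⧸ (s i).subgroupOf (s (i + 1))) :=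
        Group.isSolvable_of_comm (IsCyclic.commGroup.mul_comm)
      refine Group.isSolvable_of_ker_le_range (inclusion hle)
        (QuotientGroup.mk' ((s i).subgroupOf (s (i + 1)))) ?_
      rw [QuotientGroup.ker_mk', inclusion_range]


/-! ### Powers acting nilpotently, and the conclusion -/

theorem Subgroup.exists_pow_commutator_mem_of_finite {G : Type*} [Group G] {K H : Subgroup G}
    [K.Normal] [H.Normal] (hfin : Finite (H ⧸ K.subgroupOf H)) (x : G) :
    ∃ k > 0, ∀ l, k ∣ l → ∀ a ∈ H, ⁅a, x ^ l⁆ ∈ K := by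
  set π := QuotientGroup.mk' K with hπ
  have hn : (H.map π).Normal := inferInstance
  have : Finite (H.map π) := by
    refine Finite.of_surjective (QuotientGroup.lift (K.subgroupOf H) (π.subgroupMap H) ?_)
      (QuotientGroup.lift_surjective_of_surjective _ _ (π.subgroupMap_surjective H) _)
    intro a ha
    exact Subtype.ext ((QuotientGroup.eq_one_iff _).mpr (mem_subgroupOf.mp ha))
  have : Finite (MulAut (H.map π)) := Finite.of_injective _ DFunLike.coe_injective
  -- The order of the finite automorphism group kills the conjugation action.
  refine ⟨Nat.card (MulAut (H.map π)), Nat.card_pos, ?_⟩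
  rintro _ ⟨l, rfl⟩ a ha
  have h1 : MulAut.conjNormal (H := H.map π) (π (x ^ (Nat.card (MulAut (H.map π)) * l))) = 1 := by
    rw [map_pow, map_pow, pow_mul, pow_card_eq_one', one_pow]
  have h2 := congrArg Subtype.val (DFunLike.congr_fun h1 ⟨π a, mem_map_of_mem π ha⟩)
  rw [MulAut.conjNormal_apply, MulAut.one_apply, mul_inv_eq_iff_eq_mul] at h2
  refine (QuotientGroup.eq_one_iff _).mp ((map_commutatorElement π _ _).trans ?_)
  exact commutatorElement_eq_one_iff_mul_comm.mpr h2.symm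

theorem Subgroup.exists_pow_engel_of_isVirtuallyNilpotent {G : Type*} [Group G] {K H T : Subgroup G}
    [K.Normal] {x : G} (hx : x ∈ T) (hH : H ≤ T)
    (hT : Group.IsVirtuallyNilpotent (T ⧸ K.subgroupOf T)) :
    ∃ k > 0, ∀ l, k ∣ l → ∃ m : ℕ, ∀ a ∈ H, (fun b => ⁅b, x ^ l⁆)^[m] a ∈ K := by
  obtain ⟨k, hk, h⟩ := hT.exists_pow_engel
  refine ⟨k, hk, fun l hl => ?_⟩
  obtain ⟨m, hm⟩ := h (QuotientGroup.mk' _ ⟨x, hx⟩) l hl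
  refine ⟨m, fun a ha => ?_⟩
  have h1 := hm (QuotientGroup.mk' _ ⟨a, hH ha⟩)
  rw [← map_pow, ← MonoidHom.map_commutator_iterate, ← MonoidHom.mem_ker, QuotientGroup.ker_mk',
    mem_subgroupOf] at h1
  have h2 := MonoidHom.map_commutator_iterate T.subtype (⟨x, hx⟩ ^ l) ⟨a, hH ha⟩ m
  rw [map_pow] at h2
  exact h2 ▸ h1

/-- If every element has a power acting nilpotently on each factor of the lower central series of
a nilpotent normal subgroup `F`, then every element has a power generating a nilpotent subgroup
together with `F`. -/
theorem Subgroup.exists_pow_isNilpotent_closure {G : Type*} [Group G] {F : Subgroup G} [F.Normal]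
    (hF : Group.IsNilpotent F) (x : G)
    (h : ∀ i, ∃ k > 0, ∀ l, k ∣ l → ∃ m : ℕ, ∀ a ∈ F.lowerCentralSeries i,
      (fun b => ⁅b, x ^ l⁆)^[m] a ∈ F.lowerCentralSeries (i + 1)) :
    ∃ k > 0, Group.IsNilpotent (closure ((F : Set G) ∪ {x ^ k})) := by
  obtain ⟨n, hn⟩ := (isNilpotent_iff_lowerCentralSeries F).mp hF
  choose k hk hkl using h
  refine ⟨∏ i ∈ Finset.range n, k i, Finset.prod_pos fun i _ => hk i,
    isNilpotent_closure_insert hF _ fun i => ?_⟩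
  rcases lt_or_ge i n with hi | hi
  · exact hkl i _ (Finset.dvd_prod_of_mem k (Finset.mem_range.mpr hi))
  · refine ⟨0, fun a ha => ?_⟩
    have := F.lowerCentralSeries_antitone hi ha
    rw [hn, mem_bot] at this
    rw [Function.iterate_zero, id, this]
    exact one_mem _

/-- Let `F` be the largest nilpotent normal subgroup of a solvable group `G` with finitely generated
subgroups. If every element of `G` has a power generating a nilpotent subgroup together with `F`,
then `F` has finite index. -/
theorem Group.finite_quotient_of_exists_pow_isNilpotent {G : Type*} [Group G] [Group.IsSolvable G]
    (hfg : ∀ H : Subgroup G, H.FG) {F : Subgroup G} [F.Normal]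
    (hF : ∀ N : Subgroup G, N.Normal → Group.IsNilpotent N → N ≤ F)
    (h : ∀ x : G, ∃ k > 0, Group.IsNilpotent (closure ((F : Set G) ∪ {x ^ k}))) :
    Finite (G ⧸ F) := by
  refine Group.finite_of_forall_abelian_normal_finite (forall_fg_quotient hfg F) fun A hA hcomm => ?_
  set π := QuotientGroup.mk' F with hπ
  have hFC : F ≤ A.comap π := QuotientGroup.le_comap_mk' F A
  have htor : IsMulTorsion A := by
    rintro ⟨a, ha⟩
    obtain ⟨c, rfl⟩ := QuotientGroup.mk'_surjective F a
    obtain ⟨k, hk, hnil⟩ := h c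
    set E := closure ((F : Set G) ∪ {c ^ k}) with hE
    have hFE : F ≤ E := fun x hx => subset_closure (Or.inl hx)
    have hcE : c ^ k ∈ E := subset_closure (Or.inr rfl)
    have hEC : E ≤ A.comap π := by
      rw [hE, closure_le]
      exact Set.union_subset hFC (Set.singleton_subset_iff.mpr (pow_mem (mem_comap.mpr ha) k))
    have hnorm : (E.subgroupOf (A.comap π)).Normal := by
      refine ⟨fun n hn g => ?_⟩
      rw [mem_subgroupOf] at hn ⊢
      -- As `A` is abelian, conjugation in its preimage changes elements only by factors in `F ≤ E`.
      have hcom : ⁅(g : G), (n : G)⁆ ∈ F := by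
        refine (QuotientGroup.eq_one_iff _).mp ((map_commutatorElement π _ _).trans ?_)
        exact commutatorElement_eq_one_iff_mul_comm.mpr
          (congrArg Subtype.val (mul_comm' (⟨π g, g.2⟩ : A) ⟨π n, n.2⟩))
      have := E.mul_mem (hFE hcom) hn
      simpa [commutatorElement_def] using this
    have hck := le_of_isNilpotent_of_normal_subgroupOf hfg hF hEC hnil hcE
    refine isOfFinOrder_iff_pow_eq_one.mpr ⟨k, hk, Subtype.ext ?_⟩
    exact (map_pow π c k).symm.trans ((QuotientGroup.eq_one_iff _).mpr hck)
  have : Group.FG A := (Group.fg_iff_subgroup_fg A).mpr (forall_fg_quotient hfg F A)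
  let _ : CommGroup A := { (inferInstance : Group A) with mul_comm := mul_comm' }
  exact CommGroup.finite_of_fg_isMulTorsion A htor

theorem mainTheorem7 {G : Type*} [Group G] (hG : IsPolycyclicGroup G)
    (hvn : ¬ Group.IsVirtuallyNilpotent G) :
    ∃ (x : G) (K H : Subgroup G) (_ : K.Normal) (_ : H.Normal),
      K ≤ H ∧ Group.IsNilpotent K ∧ Group.IsNilpotent H ∧
      Infinite (↥H ⧸ K.subgroupOf H) ∧
      IsMulCommutative (↥H ⧸ K.subgroupOf H) ∧
      ¬ Group.IsVirtuallyNilpotent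
        (↥(Subgroup.closure ({x} ∪ (H : Set G))) ⧸
          K.subgroupOf (Subgroup.closure ({x} ∪ (H : Set G)))) := by
  by_contra hneg
  obtain ⟨hfg, hsol⟩ := hG.forall_fg_and_isSolvable
  obtain ⟨F, hFchar, hFnil, hmax⟩ := exists_greatest_nilpotent_normal hfg
  have hfin : Finite (G ⧸ F) := by
    refine Group.finite_quotient_of_exists_pow_isNilpotent hfg hmax fun x =>
      exists_pow_isNilpotent_closure hFnil x fun i => ?_
    have hle : F.lowerCentralSeries (i + 1) ≤ F.lowerCentralSeries i :=
      F.lowerCentralSeries_antitone i.le_succ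
    have hnil : ∀ j, Group.IsNilpotent (F.lowerCentralSeries j) := fun j =>
      (isNilpotent_subgroupOf_iff (lowerCentralSeries_le_self F j)).mp inferInstance
    rcases finite_or_infinite (F.lowerCentralSeries i ⧸
      (F.lowerCentralSeries (i + 1)).subgroupOf (F.lowerCentralSeries i)) with hq | hq
    · obtain ⟨k, hk, h⟩ := exists_pow_commutator_mem_of_finite hq x
      exact ⟨k, hk, fun l hl => ⟨1, h l hl⟩⟩
    · refine exists_pow_engel_of_isVirtuallyNilpotent
        (T := closure ({x} ∪ (F.lowerCentralSeries i : Set G)))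
        (subset_closure (Or.inl rfl)) (fun a ha => subset_closure (Or.inr ha)) ?_
      by_contra hT
      refine hneg ⟨x, _, _, inferInstance, inferInstance, hle, hnil _, hnil _, hq, ?_, hT⟩
      -- Commutativity holds as `[γ_i F, γ_i F] ≤ [γ_i F, F] = γ_{i+1} F`.
      rw [Subgroup.Normal.quotient_commutative_iff_commutator_le, ← map_subtype_le_map_subtype,
        map_subtype_commutator, map_subgroupOf_eq_of_le hle,
        Subgroup.lowerCentralSeries_succ]
      exact commutator_mono le_rfl (lowerCentralSeries_le_self F i)
  exact hvn ⟨F, hFnil, finiteIndex_of_finite_quotient⟩
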